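/- Let $G$ be a finite loopless digraph and $s\ge 1$ an integer. In the guessing game $(G,s)$ every vertex $v$ is assigned a value $a_v\in A_s=\{0,\dots,s-1\}$, uniformly and independently at random. A strategy $\mathcal F=(f_v)_{v\in V(G)}$ consists of functions $f_v\colon A_s^{\Gamma^-(v)}\to A_s$, where $\Gamma^-(v)=\{u: uv\in E(G)\}$; player $v$ guesses $f_v\big((a_u)_{u\in\Gamma^-(v)}\big)$, and the players win if every $v$ guesses $a_v$. Put $$\mathrm{gn}(G,s)=|V(G)|+\log_s\Big(\max_{\mathcal F}\mathbf P[\text{the players win with }\mathcal F]\Big),\qquad \mathrm{gn}(G)=\lim_{s\to\infty}\mathrm{gn}(G,s).$$ An undirected graph is regarded as the digraph containing both $uv$ and $vu$ for every undirected edge $uv$. Let $R$ be the undirected graph with vertices $1,\dots,10$ and the following $27$ edges: $1$ is joined to each of $2,\dots,7$; the edges $23,34,45,56,67,72$ form a hexagon; $8,9,10$ form a triangle; $8$ is joined to $3,4,6,7$; $9$ is joined to $2,3,5,6$; and $10$ is joined to $2,7,4,5$. Let $R_c$ be obtained from $R$ by cloning the vertices $8,9,10$: add vertices $8',9',10'$,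 and join two of the $13$ vertices exactly when the vertices of $R$ from which they stem are adjacent (so a vertex is not joined to its clone). Let $R_c^-$ be the undirected graph $R_c$ with the undirected edge between $3$ and $8$ removed, and let $R_c^+$ be the digraph $R_c^-$ with the single directed edge from $3$ to $8$ added (so player $8$ sees player $3$, but player $3$ does not see player $8$). **Theorem.** The limits defining $\mathrm{gn}(R_c^-)$ and $\mathrm{gn}(R_c^+)$ exist, and $$\mathrm{gn}(R_c^-)=\frac{53}{6},\qquad \mathrm{gn}(R_c^+)=9.$$ In particular, adding a single directed edge between two non-adjacent vertices of an undirected graph can increase its asymptotic guessing number. -/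

import Mathlib

open Filter Topology

namespace GuessingGame

section Game

variable {V : Type*} [Fintype V]

/-- The in-neighbourhood of `v`: the players whose values player `v` sees. -/
abbrev InNeighbor {V : Type*} (G : Digraph V) (v : V) : Type _ := {u : V // G.Adj u v}

/-- A (pure) strategy for the guessing game `(G, s)`: for every player `v` a function from the
values of the in-neighbours of `v` to the alphabet `Fin s`. -/
abbrev Strategy {V : Type*} (G : Digraph V) (s : ℕ) : Type _ :=
  (v : V) → (InNeighbor G v → Fin s) → Fin s

/-- The event that all players guess their own value correctly. -/
def win {V : Type*} (G : Digraph V) (s : ℕ) (F : Strategy G s) : Set (V → Fin s) :=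
  {a | ∀ v, F v (fun u => a u.1) = a v}

/-- The probability of winning when the values are independent and uniform on `Fin s`, that is,
when the assignment is uniform on `V → Fin s`. -/
noncomputable def winProb (G : Digraph V) (s : ℕ) (F : Strategy G s) : ℝ :=
  ((win G s F).ncard : ℝ) / (s : ℝ) ^ Fintype.card V

/-- The guessing number `gn(G, s) = |V(G)| + log_s (max_F P[Win(G, s, F)])`.  For `s ≥ 1` the
supremum is over a finite nonempty family, hence is a maximum. -/
noncomputable def guessingNumber (G : Digraph V) (s : ℕ) : ℝ :=
  Fintype.card V + Real.logb s (⨆ F : Strategy G s, winProb G s F)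

/-- `G` has asymptotic guessing number `x`: the guessing numbers `gn(G, s)` converge to `x` as the
alphabet size `s` tends to infinity. -/
def HasAsymptoticGuessingNumber (G : Digraph V) (x : ℝ) : Prop :=
  Tendsto (fun s : ℕ => guessingNumber G s) atTop (𝓝 x)

end Game

/-- An undirected graph as a digraph: every undirected edge gives both directed edges. -/
def toDigraph {V : Type*} (G : SimpleGraph V) : Digraph V where
  Adj := G.Adj

/-- Add the single directed edge from `u` to `v`. -/
def addArc {V : Type*} (G : Digraph V) (u v : V) : Digraph V where
  Adj x y := G.Adj x y ∨ (x = u ∧ y = v)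

/-- The ten vertices `1, …, 10` of the graph `R`. -/
inductive RVertex
  | v1 | v2 | v3 | v4 | v5 | v6 | v7 | v8 | v9 | v10
  deriving DecidableEq

open RVertex

instance : Fintype RVertex where
  elems := {v1, v2, v3, v4, v5, v6, v7, v8, v9, v10}
  complete v := by cases v <;> decide

/-- The 27 edges of `R`: the hub `1` is joined to the hexagon `2 3 4 5 6 7`, the vertices
`8, 9, 10` form a triangle, and each of them is joined to the ends of two opposite edges of the
hexagon. -/
def REdges : List (RVertex × RVertex) :=
  [(v1, v2), (v1, v3), (v1, v4), (v1, v5), (v1, v6), (v1, v7),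
   (v2, v3), (v3, v4), (v4, v5), (v5, v6), (v6, v7), (v7, v2),
   (v8, v9), (v8, v10), (v9, v10),
   (v8, v3), (v8, v4), (v8, v6), (v8, v7),
   (v9, v2), (v9, v3), (v9, v5), (v9, v6),
   (v10, v2), (v10, v7), (v10, v4), (v10, v5)]

/-- The undirected graph `R` on ten vertices. -/
def R : SimpleGraph RVertex where
  Adj u v := (u, v) ∈ REdges ∨ (v, u) ∈ REdges
  symm := ⟨fun _ _ h => h.symm⟩
  loopless := ⟨fun v => by cases v <;> simp [REdges]⟩

/-- The vertices `8, 9, 10` of `R`, which are cloned to form `R_c`. -/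
def clonedVertices : Finset RVertex := {v8, v9, v10}

/-- The thirteen vertices of `R_c`: `Sum.inl v` is the original vertex `v` and `Sum.inr v` is the
clone `v'` of a vertex `v` among `8, 9, 10`. -/
abbrev RcVertex : Type := RVertex ⊕ {v : RVertex // v ∈ clonedVertices}

/-- `R_c`: two vertices are adjacent if and only if the vertices of `R` from which they stem are.
In particular a vertex and its clone are not adjacent. -/
def Rc : SimpleGraph RcVertex :=
  R.comap (Sum.elim id Subtype.val)

/-- `R_c^-`: the graph `R_c` without the undirected edge between `3` and `8`. -/
def RcMinus : SimpleGraph RcVertex :=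
  Rc.deleteEdges {s(Sum.inl v3, Sum.inl v8)}

/-- `R_c^+`: the digraph `R_c^-` with the additional directed edge from `3` to `8`. -/
def RcPlus : Digraph RcVertex :=
  addArc (toDigraph RcMinus) (Sum.inl v3) (Sum.inl v8)

end GuessingGame

namespace GuessingGame

/-! ### Entropy of partitions of a finite set. -/

section Entropy

variable {Ω : Type*} [Fintype Ω]

/-! Winning sets are codes: sets of assignments in which each value is a function of the values its
player sees. So both limits amount to finding the largest codes, up to lower-order factors.

Lower bounds come from kernels of linear maps over powers of `ZMod 3`. For `RcPlus`, the four
equations of `axialMap` cut 13 symbols down to 9 free ones. For `RcMinus`, each player holds six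
symbols. Three copies of the previous code use 12 equations, with 8' playing both itself and 8: it
sees 3 and is seen by everyone who must see 8. The symbols left over are covered by 13 triangles,
each with one equation that its members can solve. This leaves 78 - 12 - 13 = 53 free symbols, hence
53/6 (`eq_zero_of_mixedMap_eq_zero`).

For `RcPlus` the upper bound 9 = 13 - 4 comes from an independent set of size four. For `RcMinus`,
take a uniform element of the code: the joint entropies of its coordinates are submodular, and
adding a player whose neighbours are all present costs nothing. A combination of such inequalities
gives 53/6 (`six_mul_le_of_submodular`). `hasAsymptoticGuessingNumber_of_codes` turns the two kinds
of bound into a limit. -/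

open Classical in
/-- The number of elements in the class of `a`. -/
noncomputable def classCard (r : Setoid Ω) (a : Ω) : ℕ :=
  (Finset.univ.filter fun b => r b a).card

/-- The entropy of the class of a uniformly random element, multiplied by the number of
elements. -/
noncomputable def entropy (r : Setoid Ω) : ℝ :=
  ∑ a : Ω, Real.log (Fintype.card Ω / classCard r a)

lemma classCard_pos (r : Setoid Ω) (a : Ω) : 0 < classCard r a := by
  classical
  exact Finset.card_pos.mpr ⟨a, by simp⟩

lemma classCard_le_card (r : Setoid Ω) (a : Ω) : classCard r a ≤ Fintype.card Ω := by
  classical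
  exact Finset.card_le_univ _

lemma classCard_mono {r s : Setoid Ω} (h : r ≤ s) (a : Ω) : classCard r a ≤ classCard s a := by
  classical
  exact Finset.card_le_card fun b hb => by
    simp only [Finset.mem_filter, Finset.mem_univ, true_and] at hb ⊢
    exact h hb

lemma classCard_congr {r : Setoid Ω} {a b : Ω} (h : r a b) : classCard r a = classCard r b := by
  classical
  unfold classCard
  congr 1
  ext c
  simp only [Finset.mem_filter, Finset.mem_univ, true_and]
  exact ⟨fun hc => r.trans hc h, fun hc => r.trans hc (r.symm h)⟩

lemma entropy_nonneg (r : Setoid Ω) : 0 ≤ entropy r := by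
  refine Finset.sum_nonneg fun a _ => Real.log_nonneg ?_
  rw [one_le_div (by exact_mod_cast classCard_pos r a)]
  exact_mod_cast classCard_le_card r a

lemma entropy_anti {r s : Setoid Ω} (h : r ≤ s) : entropy s ≤ entropy r := by
  refine Finset.sum_le_sum fun a _ => ?_
  have h1 : (0 : ℝ) < classCard r a := by exact_mod_cast classCard_pos r a
  have h2 : (classCard r a : ℝ) ≤ classCard s a := by exact_mod_cast classCard_mono h a
  have h3 : (0 : ℝ) < Fintype.card Ω := by exact_mod_cast Fintype.card_pos_iff.mpr ⟨a⟩
  exact Real.log_le_log (div_pos h3 (h1.trans_le h2)) (by gcongr)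

/-- Double counting: the numerator counts pairs `(b, c)` with `b` in the `r`-class and `c` in the
`s`-class of `a`. For a fixed pair, the possible `a` are empty or one class of `r ⊓ s`, on which the
weight is constant, so the pair contributes at most the reciprocal of a `t`-class that contains both
`b` and `c`. -/
lemma sum_div_classCard_mul_classCard_le {r s t : Setoid Ω} (hr : r ≤ t) (hs : s ≤ t) :
    ∑ a : Ω, (classCard r a * classCard s a : ℝ) / (classCard (r ⊓ s) a * classCard t a) ≤
      Fintype.card Ω := by
  classical
  have hpos (q : Setoid Ω) (a : Ω) : (0 : ℝ) < classCard q a := by exact_mod_cast classCard_pos q a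
  have key (b c : Ω) : ∑ a : Ω, (if r b a ∧ s c a then
      (1 : ℝ) / (classCard (r ⊓ s) a * classCard t a) else 0) ≤
      if t c b then 1 / (classCard t b : ℝ) else 0 := by
    by_cases hex : ∃ a, r b a ∧ s c a
    · obtain ⟨d, hbd, hcd⟩ := hex
      have hcb : t c b := t.trans (hs hcd) (t.symm (hr hbd))
      rw [if_pos hcb]
      have hrw (a : Ω) : (if r b a ∧ s c a then
          (1 : ℝ) / (classCard (r ⊓ s) a * classCard t a) else 0) =
          if (r ⊓ s) a d then 1 / (classCard (r ⊓ s) d * classCard t b : ℝ) else 0 := by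
        have hiff : (r b a ∧ s c a) ↔ (r ⊓ s) a d := by
          exact ⟨fun h => ⟨r.trans (r.symm h.1) hbd, s.trans (s.symm h.2) hcd⟩,
            fun h => ⟨r.trans hbd (r.symm h.1), s.trans hcd (s.symm h.2)⟩⟩
        by_cases h : r b a ∧ s c a
        · rw [if_pos h, if_pos (hiff.mp h), classCard_congr (hiff.mp h),
            classCard_congr (hr h.1)]
        · rw [if_neg h, if_neg (fun h' => h (hiff.mpr h'))]
      rw [Finset.sum_congr rfl fun a _ => hrw a, ← Finset.sum_filter, Finset.sum_const,
        nsmul_eq_mul]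
      change (classCard (r ⊓ s) d : ℝ) * _ ≤ _
      have := hpos (r ⊓ s) d
      have := hpos t b
      apply le_of_eq
      field_simp
    · push Not at hex
      rw [Finset.sum_eq_zero fun a _ => if_neg fun h => hex a h.1 h.2]
      split_ifs
      · exact (one_div_pos.mpr (hpos t b)).le
      · exact le_rfl
  have hexp (a : Ω) : (classCard r a * classCard s a : ℝ) /
      (classCard (r ⊓ s) a * classCard t a) = ∑ b : Ω, ∑ c : Ω, if r b a ∧ s c a then
      (1 : ℝ) / (classCard (r ⊓ s) a * classCard t a) else 0 := by
    have hc (q : Setoid Ω) : (classCard q a : ℝ) = ∑ b : Ω, if q b a then (1 : ℝ) else 0 := by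
      simp [classCard]
    rw [hc r, hc s, Finset.sum_mul_sum, Finset.sum_div]
    refine Finset.sum_congr rfl fun b _ => ?_
    rw [Finset.sum_div]
    refine Finset.sum_congr rfl fun c _ => ?_
    by_cases h1 : r b a <;> by_cases h2 : s c a <;> simp [h1, h2]
  calc _ = ∑ b : Ω, ∑ c : Ω, ∑ a : Ω, (if r b a ∧ s c a then
          (1 : ℝ) / (classCard (r ⊓ s) a * classCard t a) else 0) := by
        rw [Finset.sum_congr rfl fun a _ => hexp a, Finset.sum_comm]
        exact Finset.sum_congr rfl fun b _ => Finset.sum_comm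
    _ ≤ ∑ b : Ω, ∑ c : Ω, if t c b then 1 / (classCard t b : ℝ) else 0 :=
        Finset.sum_le_sum fun b _ => Finset.sum_le_sum fun c _ => key b c
    _ = ∑ _b : Ω, (1 : ℝ) := by
        refine Finset.sum_congr rfl fun b _ => ?_
        rw [← Finset.sum_filter, Finset.sum_const, nsmul_eq_mul]
        exact mul_one_div_cancel (hpos t b).ne'
    _ = Fintype.card Ω := by simp

/-- Submodularity of entropy. -/
lemma entropy_inf_add_le {r s t : Setoid Ω} (hr : r ≤ t) (hs : s ≤ t) :
    entropy (r ⊓ s) + entropy t ≤ entropy r + entropy s := by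
  have hpos (q : Setoid Ω) (a : Ω) : (0 : ℝ) < classCard q a := by exact_mod_cast classCard_pos q a
  have h := sum_div_classCard_mul_classCard_le hr hs
  have hle : entropy (r ⊓ s) + entropy t - entropy r - entropy s ≤
      ∑ a : Ω, ((classCard r a * classCard s a : ℝ) /
        (classCard (r ⊓ s) a * classCard t a) - 1) := by
    simp only [entropy, ← Finset.sum_add_distrib, ← Finset.sum_sub_distrib]
    refine Finset.sum_le_sum fun a _ => ?_
    have hN : (Fintype.card Ω : ℝ) ≠ 0 := by
      exact_mod_cast (Fintype.card_pos_iff.mpr ⟨a⟩).ne'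
    have h1 := hpos r a
    have h2 := hpos s a
    have h3 := hpos t a
    have h4 := hpos (r ⊓ s) a
    -- The pointwise entropy difference is the logarithm of the ratio bounded on average above; `log
    -- x ≤ x - 1` replaces Jensen's inequality.
    refine le_trans (le_of_eq ?_) (Real.log_le_sub_one_of_pos (by positivity))
    rw [Real.log_div hN h4.ne', Real.log_div hN h3.ne', Real.log_div hN h1.ne',
      Real.log_div hN h2.ne', Real.log_div (by positivity) (by positivity),
      Real.log_mul h1.ne' h2.ne', Real.log_mul h4.ne' h3.ne']
    ring
  rw [Finset.sum_sub_distrib, Finset.sum_const, nsmul_eq_mul, mul_one, Finset.card_univ] at hle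
  linarith

lemma sum_one_div_classCard_ker_le {β : Type*} [Fintype β] (f : Ω → β) :
    ∑ a : Ω, (1 : ℝ) / classCard (Setoid.ker f) a ≤ Fintype.card β := by
  classical
  rw [← Finset.sum_fiberwise (s := Finset.univ) (g := f)]
  calc _ ≤ ∑ _b : β, (1 : ℝ) := Finset.sum_le_sum fun b _ => ?_
    _ = Fintype.card β := by simp
  rcases (Finset.univ.filter fun a => f a = b).eq_empty_or_nonempty with h | ⟨d, hd⟩
  · simp [h]
  · have hd' : f d = b := by simpa using hd
    have hc : classCard (Setoid.ker f) d = (Finset.univ.filter fun a => f a = b).card := by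
      unfold classCard
      congr 1
      ext c
      simp [hd']
    rw [Finset.sum_congr rfl (g := fun _ => (1 : ℝ) / classCard (Setoid.ker f) d),
      Finset.sum_const, nsmul_eq_mul, hc]
    · exact (mul_one_div_cancel (by
        rw [← hc]; exact_mod_cast (classCard_pos (Setoid.ker f) d).ne')).le
    · intro a ha
      have ha' : f a = b := by simpa using ha
      rw [classCard_congr (show Setoid.ker f a d from ha'.trans hd'.symm)]

/-- Each nonempty fibre contributes exactly 1 to the sum of reciprocal class sizes; `log x ≤ x - 1`
turns this count into an entropy bound. -/
lemma entropy_ker_le {β : Type*} [Fintype β] (f : Ω → β) :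
    entropy (Setoid.ker f) ≤ Fintype.card Ω * Real.log (Fintype.card β) := by
  rcases isEmpty_or_nonempty Ω with hΩ | ⟨⟨d⟩⟩
  · simp [entropy]
  have hN : (0 : ℝ) < Fintype.card Ω := by exact_mod_cast Fintype.card_pos_iff.mpr ⟨d⟩
  have hβ : (0 : ℝ) < Fintype.card β := by exact_mod_cast Fintype.card_pos_iff.mpr ⟨f d⟩
  have hle : entropy (Setoid.ker f) - Fintype.card Ω * Real.log (Fintype.card β) ≤
      ∑ a : Ω, ((Fintype.card Ω / Fintype.card β : ℝ) * (1 / classCard (Setoid.ker f) a) - 1) := by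
    have : (Fintype.card Ω * Real.log (Fintype.card β) : ℝ) =
        ∑ _a : Ω, Real.log (Fintype.card β) := by simp
    rw [this, entropy, ← Finset.sum_sub_distrib]
    refine Finset.sum_le_sum fun a _ => ?_
    have h1 : (0 : ℝ) < classCard (Setoid.ker f) a := by exact_mod_cast classCard_pos _ a
    refine le_trans (le_of_eq ?_) (Real.log_le_sub_one_of_pos (by positivity))
    rw [Real.log_div hN.ne' h1.ne', Real.log_mul (by positivity) (by positivity),
      Real.log_div hN.ne' hβ.ne', Real.log_div one_ne_zero h1.ne', Real.log_one]
    ring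
  rw [Finset.sum_sub_distrib, ← Finset.mul_sum, Finset.sum_const, nsmul_eq_mul, mul_one,
    Finset.card_univ] at hle
  have h := mul_le_mul_of_nonneg_left (sum_one_div_classCard_ker_le f)
    (div_pos hN hβ).le
  rw [div_mul_cancel₀ _ hβ.ne'] at h
  linarith

lemma entropy_bot : entropy (⊥ : Setoid Ω) = Fintype.card Ω * Real.log (Fintype.card Ω) := by
  classical
  have h (a : Ω) : classCard (⊥ : Setoid Ω) a = 1 := by
    refine Finset.card_eq_one.mpr ⟨a, ?_⟩
    ext b
    simp
  simp [entropy, h]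

end Entropy

/-! ### Codes, strategies and the passage to the limit. -/

section Codes

variable {V : Type*}

/-- A set of assignments in which the value of every player is determined by the values that the
player sees. -/
def IsCode (G : Digraph V) {A : Type*} (W : Set (V → A)) : Prop :=
  ∀ a ∈ W, ∀ b ∈ W, ∀ v, (∀ u, G.Adj u v → a u = b u) → a v = b v

lemma isCode_win [Fintype V] (G : Digraph V) (s : ℕ) (F : Strategy G s) :
    IsCode G (win G s F) := by
  intro a ha b hb v h
  rw [← ha v, ← hb v]
  congr 1
  ext u
  rw [h u.1 u.2]

variable [Fintype V]

lemma exists_strategy_of_isCode {G : Digraph V} {A : Type*} [Finite A] {W : Set (V → A)}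
    (hW : IsCode G W) {s : ℕ} [NeZero s] (hs : Nat.card A ≤ s) :
    ∃ F : Strategy G s, W.ncard ≤ (win G s F).ncard := by
  classical
  have : Fintype A := Fintype.ofFinite A
  obtain ⟨f⟩ : Nonempty (A ↪ Fin s) :=
    Function.Embedding.nonempty_of_card_le (by simpa [Nat.card_eq_fintype_card] using hs)
  -- The player picks any codeword compatible with what it sees; the code property makes its own
  -- value independent of the choice. The default 0 is never used on an embedded codeword.
  let F : Strategy G s := fun v x =>
    if h : ∃ a ∈ W, ∀ u : InNeighbor G v, f (a u.1) = x u then f (h.choose v) else 0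
  refine ⟨F, ?_⟩
  rw [← Set.ncard_image_of_injective W (f := fun a v => f (a v))
    fun a b h => funext fun v => f.injective (congrFun h v)]
  refine Set.ncard_le_ncard ?_ (Set.toFinite _)
  rintro _ ⟨a, ha, rfl⟩ v
  have h : ∃ b ∈ W, ∀ u : InNeighbor G v, f (b u.1) = f (a u.1) := ⟨a, ha, fun _ => rfl⟩
  change (if h : ∃ b ∈ W, ∀ u : InNeighbor G v, f (b u.1) = f (a u.1) then
    f (h.choose v) else 0) = f (a v)
  rw [dif_pos h]
  exact congrArg f (hW _ h.choose_spec.1 _ ha v fun u hu =>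
    f.injective (h.choose_spec.2 ⟨u, hu⟩))

lemma guessingNumber_le {G : Digraph V} {s : ℕ} (hs : 2 ≤ s) {x : ℝ}
    (h : ∀ F : Strategy G s, ((win G s F).ncard : ℝ) ≤ (s : ℝ) ^ x) :
    guessingNumber G s ≤ x := by
  have : NeZero s := ⟨by omega⟩
  have hs1 : (1 : ℝ) < s := by exact_mod_cast hs
  have hs0 : (0 : ℝ) < s := zero_lt_one.trans hs1
  have hpos : 0 < ⨆ F : Strategy G s, winProb G s F := by
    refine lt_of_lt_of_le ?_ (le_ciSup (Set.finite_range _).bddAbove (fun _ _ => 0))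
    refine div_pos ?_ (by positivity)
    have h0 : (fun _ => 0 : V → Fin s) ∈ win G s (fun _ _ => 0) := fun _ => rfl
    exact_mod_cast (Set.ncard_pos (Set.toFinite _)).mpr ⟨_, h0⟩
  have hle : ⨆ F : Strategy G s, winProb G s F ≤ (s : ℝ) ^ (x - Fintype.card V) := by
    have : Nonempty (Strategy G s) := ⟨fun _ _ => 0⟩
    refine ciSup_le fun F => ?_
    rw [winProb, Real.rpow_sub hs0, Real.rpow_natCast]
    gcongr
    exact h F
  have := Real.logb_le_logb_of_le hs1 hpos hle
  rw [Real.logb_rpow hs0 hs1.ne'] at this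
  rw [guessingNumber]
  linarith

lemma logb_ncard_le_guessingNumber {G : Digraph V} {s : ℕ} (hs : 2 ≤ s) {A : Type*} [Finite A]
    {W : Set (V → A)} (hW : IsCode G W) (hne : W.Nonempty) (hA : Nat.card A ≤ s) :
    Real.logb s W.ncard ≤ guessingNumber G s := by
  have : NeZero s := ⟨by omega⟩
  have hs1 : (1 : ℝ) < s := by exact_mod_cast hs
  have hs0 : (0 : ℝ) < s := zero_lt_one.trans hs1
  obtain ⟨F, hF⟩ := exists_strategy_of_isCode hW hA
  have hpos : (0 : ℝ) < W.ncard := by exact_mod_cast (Set.ncard_pos (Set.toFinite _)).mpr hne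
  have hle : (W.ncard : ℝ) / (s : ℝ) ^ Fintype.card V ≤ ⨆ F : Strategy G s, winProb G s F := by
    refine le_trans ?_ (le_ciSup (Set.finite_range _).bddAbove F)
    rw [winProb]
    gcongr
  have := Real.logb_le_logb_of_le hs1 (by positivity) hle
  rw [Real.logb_div hpos.ne' (by positivity), Real.logb_pow, Real.logb_self_eq_one hs1] at this
  rw [guessingNumber]
  linarith

/-- If the winning sets have size at most `s ^ (d / k)`, and over alphabets of size `q ^ (k * j)`
there are codes of size `q ^ (d * j)`, then the asymptotic guessing number is `d / k`. -/
theorem hasAsymptoticGuessingNumber_of_codes {G : Digraph V} {q d k : ℕ} (hq : 2 ≤ q)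
    (hk : k ≠ 0)
    (hupper : ∀ s : ℕ, 2 ≤ s → ∀ F : Strategy G s,
      ((win G s F).ncard : ℝ) ≤ (s : ℝ) ^ (d / k : ℝ))
    (hlower : ∀ j : ℕ, ∃ (A : Type) (_ : Finite A) (W : Set (V → A)),
      Nat.card A = q ^ (k * j) ∧ IsCode G W ∧ q ^ (d * j) ≤ W.ncard) :
    HasAsymptoticGuessingNumber G (d / k) := by
  have hb : 1 < q ^ k := Nat.one_lt_pow hk (by omega)
  have hj : Tendsto (fun s : ℕ => Nat.log (q ^ k) s) atTop atTop :=
    tendsto_atTop_atTop.mpr fun n => ⟨(q ^ k) ^ n, fun s hs =>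
      (Nat.le_log_iff_pow_le hb ((pow_pos (by omega) n).trans_le hs).ne').mpr hs⟩
  have hlim : Tendsto (fun s : ℕ => (d / k : ℝ) *
      ((Nat.log (q ^ k) s : ℝ) / ((Nat.log (q ^ k) s : ℝ) + 1))) atTop (𝓝 (d / k)) := by
    have := (tendsto_natCast_div_add_atTop (1 : ℝ)).comp hj
    simpa using this.const_mul (d / k : ℝ)
  refine tendsto_of_tendsto_of_tendsto_of_le_of_le' hlim tendsto_const_nhds ?_ ?_
  · filter_upwards [eventually_ge_atTop 2] with s hs
    -- The largest `j` for which an alphabet of size `q ^ (k * j)` fits into `Fin s`; the rounding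
    -- costs a factor `j / (j + 1)`, which tends to 1.
    set j := Nat.log (q ^ k) s with hjdef
    obtain ⟨A, _, W, hA, hW, hcard⟩ := hlower j
    have hjs : (q ^ k) ^ j ≤ s := Nat.pow_log_le_self _ (by omega)
    have hsj : s < (q ^ k) ^ (j + 1) := Nat.lt_pow_succ_log_self hb s
    have hWpos : 0 < W.ncard := (pow_pos (by omega) _).trans_le hcard
    refine le_trans ?_ (logb_ncard_le_guessingNumber hs hW (Set.nonempty_of_ncard_ne_zero hWpos.ne')
      (by rw [hA, pow_mul]; exact hjs))
    have hs1 : (1 : ℝ) < s := by exact_mod_cast hs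
    have hq1 : (1 : ℝ) < q := by exact_mod_cast hq
    have hlq : 0 < Real.log q := Real.log_pos hq1
    have hls : 0 < Real.log s := Real.log_pos hs1
    have hk0 : (0 : ℝ) < k := by exact_mod_cast Nat.pos_of_ne_zero hk
    have h1 : (d * j : ℝ) * Real.log q ≤ Real.log W.ncard := by
      have : ((q : ℝ) ^ (d * j)) ≤ W.ncard := by exact_mod_cast hcard
      have := Real.log_le_log (by positivity) this
      rwa [Real.log_pow, Nat.cast_mul] at this
    have h2 : Real.log s ≤ (k * (j + 1) : ℝ) * Real.log q := by
      have : (s : ℝ) ≤ (q : ℝ) ^ (k * (j + 1)) := by rw [pow_mul]; exact_mod_cast hsj.le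
      have := Real.log_le_log (by positivity) this
      rw [Real.log_pow] at this
      exact_mod_cast this
    rw [Real.logb, le_div_iff₀ hls]
    calc _ ≤ (d / k : ℝ) * (j / (j + 1)) * ((k * (j + 1) : ℝ) * Real.log q) := by gcongr
      _ = (d * j : ℝ) * Real.log q := by field_simp
      _ ≤ _ := h1
  · filter_upwards [eventually_ge_atTop 2] with s hs
    exact guessingNumber_le hs (hupper s hs)

/-- The kernel of a homomorphism of finite groups, of which every player can recover his value
from the values that he sees, is a large code. -/
lemma exists_isCode_of_addMonoidHom {G : Digraph V} {A B : Type*} [AddCommGroup A] [Finite A]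
    [AddCommGroup B] [Finite B] (φ : (V → A) →+ B)
    (h : ∀ a, φ a = 0 → ∀ v, (∀ u, G.Adj u v → a u = 0) → a v = 0) :
    ∃ W : Set (V → A), IsCode G W ∧ Nat.card A ^ Fintype.card V ≤ W.ncard * Nat.card B := by
  refine ⟨φ.ker, fun a ha b hb v hv => ?_, ?_⟩
  · refine sub_eq_zero.mp (h (a - b) ((φ.ker.sub_mem ha hb)) v fun u hu => ?_)
    simp [hv u hu]
  · have h1 := φ.ker.card_mul_index
    rw [AddSubgroup.index_ker, Nat.card_fun, Nat.card_eq_fintype_card (α := V)] at h1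
    rw [← h1]
    exact Nat.mul_le_mul (Nat.card_coe_set_eq _).le
      (Nat.card_le_card_of_injective _ Subtype.val_injective)

/-- The values of the players outside a set of players that do not see each other determine
the assignment. -/
lemma ncard_win_le_of_forall_not_adj {G : Digraph V} (I : Finset V)
    (hI : ∀ u ∈ I, ∀ v ∈ I, ¬ G.Adj u v) {s : ℕ} (F : Strategy G s) :
    (win G s F).ncard ≤ s ^ (Fintype.card V - I.card) := by
  classical
  have hinj : Set.InjOn (fun (a : V → Fin s) (v : {v // v ∉ I}) => a v.1) (win G s F) := by
    intro a ha b hb hab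
    have hout (v : V) (hv : v ∉ I) : a v = b v := congrFun hab ⟨v, hv⟩
    ext v
    by_cases hv : v ∈ I
    · rw [isCode_win G s F a ha b hb v fun u hu => hout u fun hu' => hI u hu' v hv hu]
    · rw [hout v hv]
  rw [← hinj.ncard_image]
  refine (Set.ncard_le_card _).trans (le_of_eq ?_)
  simp [Nat.card_eq_fintype_card, Fintype.card_subtype_compl]

end Codes

open RVertex

section Adjacency

instance : DecidableRel R.Adj := fun u v =>
  inferInstanceAs (Decidable ((u, v) ∈ REdges ∨ (v, u) ∈ REdges))

instance : DecidableRel Rc.Adj := fun u v =>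
  inferInstanceAs (Decidable (R.Adj (Sum.elim id Subtype.val u) (Sum.elim id Subtype.val v)))

instance : DecidableRel (toDigraph RcMinus).Adj := fun u v =>
  decidable_of_iff (Rc.Adj u v ∧ s(u, v) ≠ s(Sum.inl v3, Sum.inl v8)) <| by
    change _ ↔ (Rc.deleteEdges _).Adj u v
    simp [SimpleGraph.deleteEdges_adj]

instance : DecidableRel RcPlus.Adj := fun u v =>
  inferInstanceAs (Decidable ((toDigraph RcMinus).Adj u v ∨ (u = Sum.inl v3 ∧ v = Sum.inl v8)))

/-- The clone of the vertex `8`. -/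
abbrev w8 : RcVertex := Sum.inr ⟨v8, by decide⟩

/-- The clone of the vertex `9`. -/
abbrev w9 : RcVertex := Sum.inr ⟨v9, by decide⟩

/-- The clone of the vertex `10`. -/
abbrev w10 : RcVertex := Sum.inr ⟨v10, by decide⟩

lemma forall_rcVertex {p : RcVertex → Prop} :
    (∀ u, p u) ↔ p (.inl v1) ∧ p (.inl v2) ∧ p (.inl v3) ∧ p (.inl v4) ∧ p (.inl v5) ∧
      p (.inl v6) ∧ p (.inl v7) ∧ p (.inl v8) ∧ p (.inl v9) ∧ p (.inl v10) ∧
      p w8 ∧ p w9 ∧ p w10 := by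
  refine ⟨fun h => by simp [h], ?_⟩
  rintro ⟨h1, h2, h3, h4, h5, h6, h7, h8, h9, h10, h8', h9', h10'⟩ (u | ⟨u, hu⟩)
  · cases u <;> assumption
  · cases u <;> first | assumption | exact absurd hu (by decide)

end Adjacency

/-! ### The linear codes. -/

section Codes

variable (M : Type) [CommRing M]

/-- Four linear equations from which, if 2 is invertible, every player of `R_c^+` can recover
his value: the vertices are represented by vectors in dimension four. -/
def axialMap : (RcVertex → M) →+ (Fin 4 → M) where
  toFun x := ![
    x (.inl v2) + x (.inl v5) + x (.inl v8) + x w8 + x (.inl v9) + x w9 + x (.inl v10) + x w10,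
    x (.inl v4) + x (.inl v7) - x w8 - x (.inl v9) + x w10,
    x (.inl v3) + x (.inl v6) - x (.inl v8) + x w9 - x (.inl v10),
    x (.inl v1) + x (.inl v2) + x (.inl v3) - x (.inl v4) - x (.inl v5) - x (.inl v6) +
      x (.inl v7)]
  map_zero' := by ext i; fin_cases i <;> simp
  map_add' x y := by ext i; fin_cases i <;> simp <;> ring

variable {M}

lemma eq_zero_of_axialMap_eq_zero (h2 : ∀ y : M, y + y = 0 → y = 0) {x : RcVertex → M}
    (hx : axialMap M x = 0) :
    ∀ v, (∀ u, RcPlus.Adj u v → x u = 0) → x v = 0 := by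
  have e0 := congrFun hx 0
  have e1 := congrFun hx 1
  have e2 := congrFun hx 2
  have e3 := congrFun hx 3
  simp only [axialMap, AddMonoidHom.coe_mk, ZeroHom.coe_mk, Matrix.cons_val, Pi.zero_apply]
    at e0 e1 e2 e3
  rw [forall_rcVertex]
  refine ⟨?_, ?_, ?_, ?_, ?_, ?_, ?_, ?_, ?_, ?_, ?_, ?_, ?_⟩ <;> 
    (intro h
     rw [forall_rcVertex] at h
     simp +decide only [forall_const, false_imp_iff, true_and, and_true] at h
     -- Some players recover only twice their value. For player 3, `e0 - e1 + e2 + e3` reduces to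
     -- twice its value: the unseen symbol of 8 cancels, which is why the arc from 8 to 3 is not
     -- needed.
     refine h2 _ ?_
     grind)

variable (M)

/-- Thirteen equations on the symbols of the players, one for each clique of a clique cover of
`R_c^-` in which `8'` does not occur. -/
def triangleMap : (RcVertex → Fin 6 → M) →+ (Fin 13 → M) where
  toFun a := ![
    a (.inl v1) 3 + a (.inl v2) 3 + a (.inl v3) 3,
    a (.inl v1) 4 + a (.inl v2) 4 + a (.inl v7) 3,
    a (.inl v1) 5 + a (.inl v3) 4 + a (.inl v4) 3,
    a (.inl v2) 5 + a (.inl v3) 5 + a (.inl v9) 3,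
    a (.inl v4) 4 + a (.inl v5) 3 + a (.inl v10) 3,
    a (.inl v4) 5 + a (.inl v5) 4 + a (.inl v10) 4,
    a (.inl v5) 5 + a (.inl v6) 3 + a (.inl v9) 4,
    a (.inl v6) 4 + a (.inl v7) 4 + a (.inl v8) 0,
    a (.inl v6) 5 + a (.inl v7) 5 + a (.inl v8) 1,
    a (.inl v8) 2 + a (.inl v9) 5 + a (.inl v10) 5,
    a (.inl v8) 3 + a w9 3 + a w10 3,
    a (.inl v8) 4 + a w9 4 + a w10 4,
    a (.inl v8) 5 + a w9 5 + a w10 5]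
  map_zero' := by ext i; fin_cases i <;> simp
  map_add' x y := by ext i; fin_cases i <;> simp <;> ring

/-- The `c`-th symbols of the players, where the player `8'` also plays the role of `8`. -/
def symbolMap (c : Fin 3) : (RcVertex → Fin 6 → M) →+ (RcVertex → M) where
  toFun a u := if u = .inl v8 then a w8 (c.natAdd 3) else a u (c.castAdd 3)
  map_zero' := by ext u; simp
  map_add' a b := by ext u; by_cases h : u = .inl v8 <;> simp [h]

/-- The equations defining a code for `R_c^-`. -/
def mixedMap : (RcVertex → Fin 6 → M) →+ (Fin 3 → Fin 4 → M) × (Fin 13 → M) :=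
  (AddMonoidHom.pi fun c => (axialMap M).comp (symbolMap M c)).prod (triangleMap M)

variable {M}

/-- Every last-half symbol of a player other than 8', and also every first-half symbol of 8, occurs
in exactly one equation, whose other symbols belong to neighbours. -/
lemma eq_zero_of_triangleMap_eq_zero {a : RcVertex → Fin 6 → M} (ha : triangleMap M a = 0) :
    ∀ v, (∀ u, (toDigraph RcMinus).Adj u v → a u = 0) → v ≠ w8 → ∀ c : Fin 3,
      a v (c.natAdd 3) = 0 ∧ (v = .inl v8 → a v (c.castAdd 3) = 0) := by
  have e0 := congrFun ha 0
  have e1 := congrFun ha 1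
  have e2 := congrFun ha 2
  have e3 := congrFun ha 3
  have e4 := congrFun ha 4
  have e5 := congrFun ha 5
  have e6 := congrFun ha 6
  have e7 := congrFun ha 7
  have e8 := congrFun ha 8
  have e9 := congrFun ha 9
  have e10 := congrFun ha 10
  have e11 := congrFun ha 11
  have e12 := congrFun ha 12
  simp only [triangleMap, AddMonoidHom.coe_mk, ZeroHom.coe_mk, Matrix.cons_val, Pi.zero_apply]
    at e0 e1 e2 e3 e4 e5 e6 e7 e8 e9 e10 e11 e12
  rw [forall_rcVertex]
  refine ⟨?_, ?_, ?_, ?_, ?_, ?_, ?_, ?_, ?_, ?_, ?_, ?_, ?_⟩ <;>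
    (intro h hne c
     rw [forall_rcVertex] at h
     simp +decide only [forall_const, false_imp_iff, true_and, and_true] at h
     simp only [h, Pi.zero_apply, zero_add, add_zero] at e0 e1 e2 e3 e4 e5 e6 e7 e8 e9 e10 e11 e12
     fin_cases c <;> simp_all)

/-- The triangles recover all symbols of 8 and the last halves of all others but 8'. The three axial
codes recover the first halves of all but 8, and the last half of 8', which stands for 8 there. -/
lemma eq_zero_of_mixedMap_eq_zero (h2 : ∀ y : M, y + y = 0 → y = 0) {a : RcVertex → Fin 6 → M}
    (ha : mixedMap M a = 0) (v : RcVertex)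
    (hv : ∀ u, (toDigraph RcMinus).Adj u v → a u = 0) : a v = 0 := by
  have h1 (c : Fin 3) : axialMap M (symbolMap M c a) = 0 := congrFun (congrArg Prod.fst ha) c
  have hsym (c : Fin 3) (u : RcVertex) : symbolMap M c a u =
      if u = .inl v8 then a w8 (c.natAdd 3) else a u (c.castAdd 3) := rfl
  -- Player `v` can decode the role `w` of the axial code if it sees the players of all roles seen
  -- by `w`, with 8' in place of 8.
  have hdec (c : Fin 3) (w : RcVertex)
      (hw : ∀ u, RcPlus.Adj u w → u ≠ .inl v8 ∧ (toDigraph RcMinus).Adj u v ∨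
        u = .inl v8 ∧ (toDigraph RcMinus).Adj w8 v) : symbolMap M c a w = 0 := by
    refine eq_zero_of_axialMap_eq_zero h2 (h1 c) w fun u hu => ?_
    rcases hw u hu with ⟨hne, hadj⟩ | ⟨rfl, hadj⟩
    · simp [hsym, hne, hv u hadj]
    · simp [hsym, hv w8 hadj]
  have htri := eq_zero_of_triangleMap_eq_zero (congrArg Prod.snd ha) v hv
  have hfirst (c : Fin 3) : a v (c.castAdd 3) = 0 := by
    by_cases h8 : v = .inl v8
    · exact (htri (by rw [h8]; decide) c).2 h8
    · have key : ∀ v : RcVertex, v ≠ .inl v8 → ∀ u, RcPlus.Adj u v →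
          u ≠ .inl v8 ∧ (toDigraph RcMinus).Adj u v ∨
            u = .inl v8 ∧ (toDigraph RcMinus).Adj w8 v := by decide
      have := hdec c v (key v h8)
      rwa [hsym, if_neg h8] at this
  have hsecond (c : Fin 3) : a v (c.natAdd 3) = 0 := by
    by_cases hw : v = w8
    · subst hw
      have := hdec c (.inl v8) (by decide)
      rwa [hsym, if_pos rfl] at this
    · exact (htri hw c).1
  ext i
  exact Fin.addCases (m := 3) (n := 3) (motive := fun i => a v i = 0) hfirst hsecond i

end Codes

/-! ### Counting the codes over powers of `ZMod 3`. -/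

section LowerBounds

lemma eq_zero_of_add_self_eq_zero {j : ℕ} (y : Fin j → ZMod 3) (h : y + y = 0) : y = 0 := by
  ext i
  have : ∀ z : ZMod 3, z + z = 0 → z = 0 := by decide
  exact this _ (congrFun h i)

lemma exists_isCode_rcPlus (j : ℕ) : ∃ (A : Type) (_ : Finite A) (W : Set (RcVertex → A)),
    Nat.card A = 3 ^ (1 * j) ∧ IsCode RcPlus W ∧ 3 ^ (9 * j) ≤ W.ncard := by
  obtain ⟨W, hW, hcard⟩ := exists_isCode_of_addMonoidHom (G := RcPlus)
    (axialMap (Fin j → ZMod 3)) fun a ha v hv =>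
      eq_zero_of_axialMap_eq_zero eq_zero_of_add_self_eq_zero ha v hv
  refine ⟨_, inferInstance, W, by simp, hW, ?_⟩
  have hV : Fintype.card RcVertex = 13 := by decide
  simp only [hV, Nat.card_fun, Nat.card_zmod, Nat.card_fin] at hcard
  refine Nat.le_of_mul_le_mul_right (le_trans (le_of_eq ?_) hcard) (by positivity : 0 < (3 ^ j) ^ 4)
  ring

lemma exists_isCode_rcMinus (j : ℕ) : ∃ (A : Type) (_ : Finite A) (W : Set (RcVertex → A)),
    Nat.card A = 3 ^ (6 * j) ∧ IsCode (toDigraph RcMinus) W ∧ 3 ^ (53 * j) ≤ W.ncard := by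
  obtain ⟨W, hW, hcard⟩ := exists_isCode_of_addMonoidHom (G := toDigraph RcMinus)
    (mixedMap (Fin j → ZMod 3)) fun a ha v hv =>
      eq_zero_of_mixedMap_eq_zero eq_zero_of_add_self_eq_zero ha v hv
  refine ⟨_, inferInstance, W, by simp [← pow_mul, mul_comm], hW, ?_⟩
  have hV : Fintype.card RcVertex = 13 := by decide
  simp only [hV, Nat.card_prod, Nat.card_fun, Nat.card_zmod, Nat.card_fin] at hcard
  refine Nat.le_of_mul_le_mul_right (le_trans (le_of_eq ?_) hcard)
    (by positivity : 0 < (((3 ^ j) ^ 4) ^ 3 * (3 ^ j) ^ 13))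
  ring

end LowerBounds

/-! ### Entropy of the coordinates of a code. -/

section CodeEntropy

variable {V A : Type*}

/-- Assignments in `W` are equivalent if they agree on `T`. -/
def agreeOn (W : Set (V → A)) (T : Set V) : Setoid W where
  r a b := ∀ v ∈ T, a.1 v = b.1 v
  iseqv := ⟨fun _ _ _ => rfl, fun h v hv => (h v hv).symm,
    fun h h' v hv => (h v hv).trans (h' v hv)⟩

/-- Submodularity of the entropy of a code, where the first set on the left may contain players
whose values are determined by the values on the union of the sets on the right. -/
lemma entropy_agreeOn_add_le {G : Digraph V} {W : Set (V → A)} [Fintype W] (hW : IsCode G W)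
    {T U X Y : Set V} (hX : ∀ v ∈ X, v ∈ T ∪ U ∨ ∀ u, G.Adj u v → u ∈ T ∪ U) (hY : Y ⊆ T ∩ U) :
    entropy (agreeOn W X) + entropy (agreeOn W Y) ≤
      entropy (agreeOn W T) + entropy (agreeOn W U) := by
  refine le_trans (add_le_add (entropy_anti (r := agreeOn W T ⊓ agreeOn W U) ?_) le_rfl)
    (entropy_inf_add_le (fun a b h v hv => h v (hY hv).1) (fun a b h v hv => h v (hY hv).2))
  rintro a b ⟨hT, hU⟩ v hv
  have hTU (u : V) (hu : u ∈ T ∪ U) : a.1 u = b.1 u := hu.elim (hT u) (hU u)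
  rcases hX v hv with h | h
  · exact hTU v h
  · exact hW a.1 a.2 b.1 b.2 v fun u hu => hTU u (h u hu)

lemma entropy_agreeOn_singleton_le [Fintype A] (W : Set (V → A)) [Fintype W] (v : V) :
    entropy (agreeOn W {v}) ≤ Fintype.card W * Real.log (Fintype.card A) := by
  convert entropy_ker_le fun a : W => a.1 v
  ext a b
  exact ⟨fun h => h v rfl, fun h u hu => by rw [Set.mem_singleton_iff.mp hu]; exact h⟩

lemma entropy_agreeOn_univ (W : Set (V → A)) [Fintype W] :
    entropy (agreeOn W Set.univ) = Fintype.card W * Real.log (Fintype.card W) := by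
  rw [← entropy_bot]
  congr 1
  ext a b
  exact ⟨fun h => Subtype.ext (funext fun v => h v trivial), fun h => by rw [h]⟩

end CodeEntropy

/-! ### Upper bounds for the two graphs. -/

section UpperBound

/-- The position of a vertex in the binary encoding of sets of vertices. -/
def bit : RcVertex → ℕ
  | .inl v1 => 0
  | .inl v2 => 1
  | .inl v3 => 2
  | .inl v4 => 3
  | .inl v5 => 4
  | .inl v6 => 5
  | .inl v7 => 6
  | .inl v8 => 7
  | .inl v9 => 8
  | .inl v10 => 9
  | .inr ⟨v8, _⟩ => 10
  | .inr ⟨v9, _⟩ => 11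
  | .inr _ => 12

/-- The set of vertices encoded by a natural number. -/
def bitSet (n : ℕ) : Set RcVertex := {v | n.testBit (bit v) = true}

/-- The number encoding the neighbourhood of a vertex of `R_c^-`. -/
def neighborBits : RcVertex → ℕ
  | .inl v1 => 126
  | .inl v2 => 6981
  | .inl v3 => 3339
  | .inl v4 => 5781
  | .inl v5 => 6953
  | .inl v6 => 3537
  | .inl v7 => 5795
  | .inl v8 => 7016
  | .inl v9 => 5814
  | .inl v10 => 3546
  | .inr ⟨v8, _⟩ => 7020
  | .inr ⟨v9, _⟩ => 5814
  | .inr _ => 3546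

/-- One inclusion suffices: superfluous entries in the table could only make the condition on
quadruples stricter. -/
lemma testBit_neighborBits : ∀ u v, (toDigraph RcMinus).Adj u v →
    (neighborBits v).testBit (bit u) = true := by
  decide

/-- `Y` encodes the intersection of `T` and `U`, and `X` encodes a set of vertices of which each
belongs to the union of `T` and `U` or has all its neighbours there. -/
def IsSubmodularQuadruple (T U X Y : ℕ) : Prop :=
  T &&& U = Y ∧ ∀ v, X.testBit (bit v) = true →
    (T ||| U).testBit (bit v) = true ∨ neighborBits v &&& (T ||| U) = neighborBits v

instance (T U X Y : ℕ) : Decidable (IsSubmodularQuadruple T U X Y) :=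
  inferInstanceAs (Decidable (_ ∧ _))

lemma entropy_bitSet_add_le {A : Type*} {W : Set (RcVertex → A)} [Fintype W]
    (hW : IsCode (toDigraph RcMinus) W) {T U X Y : ℕ} (h : IsSubmodularQuadruple T U X Y) :
    entropy (agreeOn W (bitSet X)) + entropy (agreeOn W (bitSet Y)) ≤
      entropy (agreeOn W (bitSet T)) + entropy (agreeOn W (bitSet U)) := by
  obtain ⟨rfl, h⟩ := h
  have hunion (v : RcVertex) (hv : (T ||| U).testBit (bit v) = true) :
      v ∈ bitSet T ∪ bitSet U := by
    simpa [bitSet, Nat.testBit_or] using hv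
  refine entropy_agreeOn_add_le hW (fun v hv => (h v hv).imp (hunion v) fun hv u hu => ?_) ?_
  · have hbit := testBit_neighborBits u v hu
    rw [← hv, Nat.testBit_and, Bool.and_eq_true] at hbit
    exact hunion u hbit.2
  · intro v hv
    simpa [bitSet, Nat.testBit_and] using hv

/-- The linear combination of Shannon inequalities that bounds the guessing number of `R_c^-`. -/
lemma six_mul_le_of_submodular (h : ℕ → ℝ) (c : ℝ) (h0 : 0 ≤ h 0)
    (hone : ∀ v, h (2 ^ bit v) ≤ c)
    (hsub : ∀ T U X Y, IsSubmodularQuadruple T U X Y → h X + h Y ≤ h T + h U) :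
    6 * h 8191 ≤ 53 * c := by
  -- These 43 inequalities, with the bounds on singletons and the empty set, form a linear
  -- programming certificate, whose multipliers `linarith` finds. The number 8191 = 2^13 - 1 encodes
  -- all vertices.
  have s0 := hsub 1 20 21 0 (by decide)
  have s1 := hsub 1 40 41 0 (by decide)
  have s2 := hsub 1 3456 3457 0 (by decide)
  have s3 := hsub 2 20 22 0 (by decide)
  have s4 := hsub 2 1024 1026 0 (by decide)
  have s5 := hsub 2 5817 5883 0 (by decide)
  have s6 := hsub 4 16 20 0 (by decide)
  have s7 := hsub 4 1024 1028 0 (by decide)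
  have s8 := hsub 8 32 40 0 (by decide)
  have s9 := hsub 16 3521 3569 0 (by decide)
  have s10 := hsub 21 4096 4117 0 (by decide)
  have s11 := hsub 22 104 127 0 (by decide)
  have s12 := hsub 29 128 157 0 (by decide)
  have s13 := hsub 40 64 104 0 (by decide)
  have s14 := hsub 41 256 297 0 (by decide)
  have s15 := hsub 63 5789 8191 29 (by decide)
  have s16 := hsub 64 1433 1497 0 (by decide)
  have s17 := hsub 64 3457 3521 0 (by decide)
  have s18 := hsub 113 512 625 0 (by decide)
  have s19 := hsub 123 3569 8191 113 (by decide)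
  have s20 := hsub 127 3391 3455 63 (by decide)
  have s21 := hsub 127 5883 8191 123 (by decide)
  have s22 := hsub 128 256 384 0 (by decide)
  have s23 := hsub 128 561 689 0 (by decide)
  have s24 := hsub 128 5653 5789 0 (by decide)
  have s25 := hsub 153 1024 1177 0 (by decide)
  have s26 := hsub 157 7161 8191 153 (by decide)
  have s27 := hsub 256 1177 1433 0 (by decide)
  have s28 := hsub 2048 809 2857 0 (by decide)
  have s29 := hsub 2048 1408 3456 0 (by decide)
  have s30 := hsub 2048 1497 3577 0 (by decide)
  have s31 := hsub 297 512 809 0 (by decide)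
  have s32 := hsub 384 1024 1408 0 (by decide)
  have s33 := hsub 512 1024 1536 0 (by decide)
  have s34 := hsub 4096 1028 5124 0 (by decide)
  have s35 := hsub 4096 2857 6969 0 (by decide)
  have s36 := hsub 4117 1536 5653 0 (by decide)
  have s37 := hsub 625 6969 7161 561 (by decide)
  have s38 := hsub 689 5124 5821 0 (by decide)
  have s39 := hsub 1026 2361 3391 0 (by decide)
  have s40 := hsub 3449 6969 8185 2361 (by decide)
  have s41 := hsub 3455 3577 8191 3449 (by decide)
  have s42 := hsub 5821 8185 8191 5817 (by decide)
  simp only [forall_rcVertex, bit, Nat.reducePow] at hone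
  linarith

lemma ncard_win_rcMinus_le {s : ℕ} (hs : 2 ≤ s) (F : Strategy (toDigraph RcMinus) s) :
    ((win _ s F).ncard : ℝ) ≤ (s : ℝ) ^ (53 / 6 : ℝ) := by
  classical
  set W := win _ s F
  have hW : IsCode (toDigraph RcMinus) W := isCode_win _ s F
  have : Fintype W := Fintype.ofFinite W
  rw [← Nat.card_coe_set_eq, Nat.card_eq_fintype_card]
  rcases (Fintype.card W).eq_zero_or_pos with h0 | hpos
  · rw [h0, Nat.cast_zero]
    positivity
  have hcard : (0 : ℝ) < Fintype.card W := by exact_mod_cast hpos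
  have hs0 : (0 : ℝ) < s := by exact_mod_cast (by omega : 0 < s)
  have huniv : bitSet 8191 = Set.univ :=
    Set.eq_univ_of_forall (by decide : ∀ v, Nat.testBit 8191 (bit v) = true)
  have hsingle (v : RcVertex) : bitSet (2 ^ bit v) = {v} := by
    ext u
    exact (by decide : ∀ u v, Nat.testBit (2 ^ bit v) (bit u) = true ↔ u = v) u v
  have key := six_mul_le_of_submodular (fun n => entropy (agreeOn W (bitSet n)))
    (Fintype.card W * Real.log s) (entropy_nonneg _)
    (fun v => by simpa [hsingle] using entropy_agreeOn_singleton_le W v)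
    (fun T U X Y => entropy_bitSet_add_le hW)
  rw [huniv, entropy_agreeOn_univ] at key
  have hlog : Real.log (Fintype.card W) ≤ 53 / 6 * Real.log s := by
    refine le_of_mul_le_mul_left ?_ hcard
    linarith
  rw [← Real.exp_log hcard, Real.rpow_def_of_pos hs0, mul_comm]
  exact Real.exp_le_exp.mpr hlog

lemma ncard_win_rcPlus_le {s : ℕ} (F : Strategy RcPlus s) : (win _ s F).ncard ≤ s ^ 9 := by
  -- Opposite hexagon vertices 2 and 5 both miss 8 and its clone, and the added arc starts outside
  -- this set.
  let I : Finset RcVertex := {.inl v2, .inl v5, .inl v8, w8}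
  have hI : Fintype.card RcVertex - I.card = 9 := by decide
  exact hI ▸ ncard_win_le_of_forall_not_adj I (by decide) F

end UpperBound

theorem hasAsymptoticGuessingNumber_rcMinus :
    HasAsymptoticGuessingNumber (toDigraph RcMinus) (53 / 6) := by
  have := hasAsymptoticGuessingNumber_of_codes (G := toDigraph RcMinus) (q := 3) (d := 53) (k := 6)
    (by norm_num) (by norm_num) (fun s hs F => by exact_mod_cast ncard_win_rcMinus_le hs F)
    exists_isCode_rcMinus
  exact_mod_cast this

theorem hasAsymptoticGuessingNumber_rcPlus : HasAsymptoticGuessingNumber RcPlus 9 := by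
  have := hasAsymptoticGuessingNumber_of_codes (G := RcPlus) (q := 3) (d := 9) (k := 1)
    (by norm_num) (by norm_num) (fun s hs F => by
      rw [Nat.cast_one, div_one, Real.rpow_natCast]
      exact_mod_cast ncard_win_rcPlus_le F)
    exists_isCode_rcPlus
  simpa using this

end GuessingGame

theorem mainTheorem3 :
    -- the two asymptotic guessing numbers
    GuessingGame.HasAsymptoticGuessingNumber
        (GuessingGame.toDigraph GuessingGame.RcMinus) (53 / 6) ∧
    GuessingGame.HasAsymptoticGuessingNumber GuessingGame.RcPlus 9 ∧
    -- adding one directed edge to an undirected graph can increase the asymptotic guessing number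
    (∃ (V : Type) (_ : Fintype V) (G : SimpleGraph V) (u v : V) (x y : ℝ),
      u ≠ v ∧ ¬ G.Adj u v ∧
      GuessingGame.HasAsymptoticGuessingNumber (GuessingGame.toDigraph G) x ∧
      GuessingGame.HasAsymptoticGuessingNumber
        (GuessingGame.addArc (GuessingGame.toDigraph G) u v) y ∧
      x < y) := by
  refine ⟨GuessingGame.hasAsymptoticGuessingNumber_rcMinus,
    GuessingGame.hasAsymptoticGuessingNumber_rcPlus, GuessingGame.RcVertex, inferInstance,
    GuessingGame.RcMinus, .inl .v3, .inl .v8, 53 / 6, 9, by decide, ?_,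
    GuessingGame.hasAsymptoticGuessingNumber_rcMinus,
    GuessingGame.hasAsymptoticGuessingNumber_rcPlus, by norm_num⟩
  change ¬ (GuessingGame.toDigraph GuessingGame.RcMinus).Adj _ _
  decide
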